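/- **Setting.** Featherweight Java (FJ) has class declarations $L=\mathtt{class}\ C\ \mathtt{extends}\ D\ \{\overline{C}\ \overline f;\ K\ \overline M\}$, methods $M = C_0\ m(\overline C\ \overline x)\{\mathtt{return}\ e;\}$ and expressions $e::=x\mid\mathtt{this}\mid e.f\mid e.m(\overline e)\mid \mathtt{new}\ C(\overline e)\mid (C)e$. A *class table* $CT$ is a finite set of clauses $C\ \mathtt{extends}\ D$, $C.\mathtt{init}(\overline C)$, $C.f:C'$, $C.m:\overline C\to C'$ with at most one clause for each $C.\mathtt{extends}$, $C.\mathtt{init}$, $C.f$, $C.m$; $\mathrm{ext}(CT)=\{(C,D)\mid (C\ \mathtt{extends}\ D)\in CT\}$, and $<:$ is the reflexive transitive closure of $\mathrm{ext}(CT)$. Field and method lookup $\mathrm{field}(f,C,CT)$, $\mathrm{mtype}(m,C,CT)$ return the first declaration in $C$ or its superclasses; $\mathrm{fields}(C,CT)=C.\mathtt{init}(\overline C)$ returns the constructor clause of $C$. The judgment $CT\vdash L\ \mathrm{OK}$ is the FJ typing of class declarations relative to $CT$: the constructor has the form $K=C(\overline{D}'\,\overline g,\overline{C}'\,\overline f)\{\mathtt{super}(\overline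 g);\mathtt{this}.\overline f=\overline f\}$, $\mathrm{fields}(D,CT)=D.\mathtt{init}(\overline{D}')$, and each method $C_0\ m(\overline C\ \overline x)\{\mathtt{return}\ e;\}$ is OK in $C$, i.e. under $\overline x:\overline C,\mathtt{this}:C$ its body has a type $E_0<:C_0$, and there is $D_1$ with $(C\ \mathtt{extends}\ D_1)\in CT$ such that $\mathrm{mtype}(m,D_1,CT)$, if defined, equals $\overline C\to C_0$. *Class types* $T$ are class names or class variables $U$. *Constraints* are $T=T'$, $T\ne T'$, $T<:T'$, $T\not<:T'$ and equalities of types or of sequences of types under a condition; a condition is a conjunction of atoms $T=T'$, $T\neq T'$. *Class table requirements* $CR$ are sets of pairs $(\mathit{CReq},\mathit{cond})$ with $\mathit{CReq}$ of the form $T.\mathtt{extends}:T'$, $T.\mathtt{init}(\overline T)$, $T.f:T'$, $T.m:\overline T\to T'$ or the optional $(T.m:\overline T\to T')_{opt}$. The co-contextual judgment $\vdash_c L\ \mathrm{OK}\mid S\mid CR$ types $L$ bottom-up without a class table: each use of a variable, field, method or constructor gets fresh class variables and yields a requirement, each method declaration of $L$ with signature $m:\overline C\to C_0$ yields $U_c.\mathtt{extends}:U_d$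 and $(U_d.m:\overline C\to C_0)_{opt}$ with $U_c,U_d$ fresh and the constraint $U_c=C$, and the constructor yields $D.\mathtt{init}(\overline{D}')$. Subtyping, equality and cast checks become constraints in $S$. Requirements of different subterms are merged by $\mathrm{merge}_{CR}$: non-overlapping requirements are kept; for two overlapping ones (both on $\mathtt{extends}$, both on $\mathtt{init}$, both on the same field name, or both on the same method name, optional or not) with receivers $T_1,T_2$ and conditions $c_1,c_2$, both are kept, with the added condition $T_1\neq T_2$, and a common requirement with condition $c_1\wedge c_2\wedge T_1=T_2$ is added (the first of the two, optional only if both are), while constraints equating their types if $T_1=T_2$ are added to $S$. For a binary relation $\Sigma$ on class names and a substitution $\sigma$ from class variables to class types, $\mathrm{solve}(\Sigma,S)=\sigma$ means that $\sigma$ satisfies every constraint of $S$, where $<:$ is read as the reflexive transitive closure of $\Sigma$ on class names; $\sigma$ is a *ground solution* if $\sigma(CR)$ (requirements and conditions) contains no class variable. A class table $CT$ *satisfies* $\sigma(CR)$ if for every $(\mathit{CReq},\mathit{cond})\in\sigma(CR)$ such that $\mathit{cond}$ holds: the clause $C\ \mathtt{extends}\ D$ is in $CT$ for $\mathit{CReq}=C.\mathtt{extends}:D$;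 $\mathrm{fields}(C,CT)=C.\mathtt{init}(\overline C)$ for $C.\mathtt{init}(\overline C)$; $\mathrm{field}(f,C,CT)=C'$ for $C.f:C'$; $\mathrm{mtype}(m,C,CT)=\overline C\to C'$ for $C.m:\overline C\to C'$; and for $(C.m:\overline C\to C')_{opt}$, $\mathrm{mtype}(m,C,CT)$, if defined, is $\overline C\to C'$. **Theorem (Equivalence of classes: $\Leftarrow$).** Let $L=\mathtt{class}\ C\ \mathtt{extends}\ D\ \{\overline C\ \overline f;\ K\ \overline M\}$ with $\vdash_c L\ \mathrm{OK}\mid S\mid CR$, let $\Sigma$ be the immediate subclass relation $\mathrm{ext}(CT_0)$ of some class table $CT_0$, and let $\mathrm{solve}(\Sigma,S)=\sigma$, where $\sigma$ is a ground solution. Assume that $\Sigma$ records the inheritance demanded by $CR$: $(C_1,C_2)\in\Sigma$ whenever $(C_1.\mathtt{extends}:C_2,\ \mathit{cond})\in\sigma(CR)$ and $\mathit{cond}$ holds. Then there exists a class table $CT$ such that $CT\vdash L\ \mathrm{OK}$, $CT$ satisfies $\sigma(CR)$, and $\mathrm{ext}(CT)=\Sigma$. -/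

import Mathlib

/-! Featherweight Java with explicit class tables, and its co-contextual formulation. -/

namespace FJ

/-! ### Names and syntax -/

abbrev CName := ℕ
abbrev FName := ℕ
abbrev MName := ℕ

/-- Term variables: ordinary (parameter) names and the self reference `this`. -/
inductive Var where
  | this : Var
  | param : ℕ → Var
  deriving DecidableEq

inductive Expr where
  | var : Var → Expr
  | field : Expr → FName → Expr
  | invk : Expr → MName → List Expr → Expr
  | new : CName → List Expr → Expr
  | cast : CName → Expr → Expr

/-- A method declaration `ret name(params) { return body; }`. -/
structure MethodDecl where
  ret : CName
  name : MName
  params : List (CName × ℕ)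
  body : Expr

/-- A constructor `name(params) { super(superArgs); this.f = g; ... }`, with one pair `(f, g)` in
`inits` for each assignment `this.f = g`. -/
structure CtorDecl where
  name : CName
  params : List (CName × FName)
  superArgs : List FName
  inits : List (FName × FName)

structure ClassDecl where
  name : CName
  super : CName
  fields : List (CName × FName)
  ctor : CtorDecl
  methods : List MethodDecl

/-- `K = C(D' g, C' f) { super(g); this.f = f }`, where `f` are the names of the declared fields
and `Dg`, `Cf` are the two groups of typed parameters. -/
def ClassDecl.CtorForm (L : ClassDecl) (Dg Cf : List (CName × FName)) : Prop :=
  Cf.map Prod.snd = L.fields.map Prod.snd ∧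
  L.ctor =
    { name := L.name
      params := Dg ++ Cf
      superArgs := Dg.map Prod.snd
      inits := (Cf.map Prod.snd).map fun f => (f, f) }

/-! ### Class tables -/

/-- What a clause or a requirement on a class is about. -/
inductive Slot where
  | ext : Slot
  | init : Slot
  | field : FName → Slot
  | method : MName → Slot
  deriving DecidableEq

/-- Class table clauses `C extends D`, `C.init(Cs)`, `C.f : C'` and `C.m : Cs → C'`. -/
inductive Clause where
  | ext (C D : CName) : Clause
  | init (C : CName) (Cs : List CName) : Clause
  | field (C : CName) (f : FName) (C' : CName) : Clause
  | method (C : CName) (m : MName) (Cs : List CName) (C' : CName) : Clause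

/-- The domain `C.extends`, `C.init`, `C.f` or `C.m` of a clause. -/
def Clause.dom : Clause → CName × Slot
  | .ext C _ => (C, .ext)
  | .init C _ => (C, .init)
  | .field C f _ => (C, .field f)
  | .method C m _ _ => (C, .method m)

/-- A class table: a finite set of clauses with at most one clause for each domain element. -/
structure ClassTable where
  clauses : Set Clause
  finite : clauses.Finite
  unique : ∀ c ∈ clauses, ∀ c' ∈ clauses, c.dom = c'.dom → c = c'

/-- The immediate subclass relation of a class table. -/
def ClassTable.ext (CT : ClassTable) : Set (CName × CName) :=
  {p | Clause.ext p.1 p.2 ∈ CT.clauses}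

/-- Subtyping relative to an immediate subclass relation: its reflexive transitive closure. -/
def SubRel (Sg : Set (CName × CName)) : CName → CName → Prop :=
  Relation.ReflTransGen fun C D => (C, D) ∈ Sg

def ClassTable.Sub (CT : ClassTable) : CName → CName → Prop :=
  SubRel CT.ext

/-- `extends(C, CT) = D`. -/
def ClassTable.Extends (CT : ClassTable) (C D : CName) : Prop :=
  Clause.ext C D ∈ CT.clauses

/-- `fields(C, CT) = C.init(Cs)`: the constructor signature of `C`. -/
def ClassTable.Fields (CT : ClassTable) (C : CName) (Cs : List CName) : Prop :=
  Clause.init C Cs ∈ CT.clauses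

/-- `field(f, C, CT) = C'`: the first declaration of `f` in `C` or its superclasses. -/
inductive ClassTable.Field (CT : ClassTable) (f : FName) : CName → CName → Prop
  | here {C C' : CName} : Clause.field C f C' ∈ CT.clauses → CT.Field f C C'
  | up {C D C' : CName} : (∀ A, Clause.field C f A ∉ CT.clauses) → CT.Extends C D →
      CT.Field f D C' → CT.Field f C C'

/-- `mtype(m, C, CT) = Cs → C'`: the first declaration of `m` in `C` or its superclasses. -/
inductive ClassTable.MType (CT : ClassTable) (m : MName) : CName → List CName → CName → Prop
  | here {C C' : CName} {Cs : List CName} :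
      Clause.method C m Cs C' ∈ CT.clauses → CT.MType m C Cs C'
  | up {C D C' : CName} {Cs : List CName} : (∀ As A, Clause.method C m As A ∉ CT.clauses) →
      CT.Extends C D → CT.MType m D Cs C' → CT.MType m C Cs C'

/-! ### Contextual typing -/

abbrev Ctx := Var → Option CName

/-- The context `x₁ : C₁, ..., xₙ : Cₙ, this : C` of a method body. -/
def methodCtx (params : List (CName × ℕ)) (C : CName) : Ctx
  | .this => some C
  | .param x => (params.find? fun p => p.2 = x).map Prod.fst

inductive HasType (CT : ClassTable) (Γ : Ctx) : Expr → CName → Prop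
  | var {x : Var} {C : CName} : Γ x = some C → HasType CT Γ (.var x) C
  | field {e : Expr} {f : FName} {Ce Ci : CName} :
      HasType CT Γ e Ce → CT.Field f Ce Ci → HasType CT Γ (.field e f) Ci
  | invk {e : Expr} {m : MName} {es : List Expr} {Ce C : CName}
      {Cs Ds : Fin es.length → CName} :
      HasType CT Γ e Ce → (∀ i, HasType CT Γ (es.get i) (Cs i)) →
      CT.MType m Ce (List.ofFn Ds) C → (∀ i, CT.Sub (Cs i) (Ds i)) →
      HasType CT Γ (.invk e m es) C
  | new {C : CName} {es : List Expr} {Cs Ds : Fin es.length → CName} :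
      (∀ i, HasType CT Γ (es.get i) (Cs i)) → CT.Fields C (List.ofFn Ds) →
      (∀ i, CT.Sub (Cs i) (Ds i)) → HasType CT Γ (.new C es) C
  | ucast {C D : CName} {e : Expr} :
      HasType CT Γ e D → CT.Sub D C → HasType CT Γ (.cast C e) C
  | dcast {C D : CName} {e : Expr} :
      HasType CT Γ e D → CT.Sub C D → C ≠ D → HasType CT Γ (.cast C e) C
  | scast {C D : CName} {e : Expr} :
      HasType CT Γ e D → ¬ CT.Sub C D → ¬ CT.Sub D C → HasType CT Γ (.cast C e) C

/-- The method `M`, declared in class `C`, is OK. -/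
def MethodOK (CT : ClassTable) (C : CName) (M : MethodDecl) : Prop :=
  (∃ E₀, HasType CT (methodCtx M.params C) M.body E₀ ∧ CT.Sub E₀ M.ret) ∧
  ∃ D, CT.Extends C D ∧
    ∀ Ds D₀, CT.MType M.name D Ds D₀ → M.params.map Prod.fst = Ds ∧ M.ret = D₀

def ClassOK (CT : ClassTable) (L : ClassDecl) : Prop :=
  ∃ Dg Cf, L.CtorForm Dg Cf ∧ CT.Fields L.super (Dg.map Prod.fst) ∧
    ∀ M ∈ L.methods, MethodOK CT L.name M

/-! ### Class types, constraints and requirements -/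

abbrev ClassVar := ℕ

inductive ClassType where
  | name : CName → ClassType
  | var : ClassVar → ClassType

/-- An atomic condition `T = T'` or `T ≠ T'`. -/
inductive CondAtom where
  | eq (T T' : ClassType) : CondAtom
  | ne (T T' : ClassType) : CondAtom

/-- A condition is a conjunction of atomic conditions. -/
abbrev Cond := List CondAtom

/-- Constraints; `eqsIf` is the equality, under a condition, of two sequences of types, which in
particular have to be equally long. -/
inductive Constraint where
  | eq (T T' : ClassType) : Constraint
  | ne (T T' : ClassType) : Constraint
  | sub (T T' : ClassType) : Constraint
  | nsub (T T' : ClassType) : Constraint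
  | eqIf (T T' : ClassType) (cond : Cond) : Constraint
  | eqsIf (Ts Ts' : List ClassType) (cond : Cond) : Constraint

/-- Class requirements. `method true T m Ts T'` is the optional requirement
`(T.m : Ts → T')_opt`, and `method false T m Ts T'` is the requirement `T.m : Ts → T'`. -/
inductive CReq where
  | ext (T T' : ClassType) : CReq
  | init (T : ClassType) (Ts : List ClassType) : CReq
  | field (T : ClassType) (f : FName) (T' : ClassType) : CReq
  | method (opt : Bool) (T : ClassType) (m : MName) (Ts : List ClassType) (T' : ClassType) : CReq

/-- The class type on which something is required. -/
def CReq.recv : CReq → ClassType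
  | .ext T _ => T
  | .init T _ => T
  | .field T _ _ => T
  | .method _ T _ _ _ => T

def CReq.slot : CReq → Slot
  | .ext _ _ => .ext
  | .init _ _ => .init
  | .field _ f _ => .field f
  | .method _ _ m _ _ => .method m

/-- Class table requirements: sets of conditional class requirements. -/
abbrev ClassReqs := Set (CReq × Cond)

/-- Context requirements: bindings from variables to class types. -/
abbrev CtxReqs := Var → Option ClassType

/-! ### Operations on requirements -/

def CtxReqs.empty : CtxReqs := fun _ => none

def CtxReqs.single (x : Var) (T : ClassType) : CtxReqs := fun y => if y = x then some T else none

/-- `R - x`. -/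
def CtxReqs.remove (R : CtxReqs) (x : Var) : CtxReqs := fun y => if y = x then none else R y

/-- The requirements of `merge_R(R₁, R₂)`. -/
def mergeR (R₁ R₂ : CtxReqs) : CtxReqs := fun x => (R₁ x).orElse fun _ => R₂ x

/-- The constraints of `merge_R(R₁, R₂)`. -/
def mergeRC (R₁ R₂ : CtxReqs) : Set Constraint :=
  {s | ∃ x T₁ T₂, R₁ x = some T₁ ∧ R₂ x = some T₂ ∧ s = .eq T₁ T₂}

/-- The requirements of `merge_R(R₁, ..., Rₙ)`. -/
def mergeRs : List CtxReqs → CtxReqs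
  | [] => .empty
  | R :: Rs => mergeR R (mergeRs Rs)

/-- The constraints of `merge_R(R₁, ..., Rₙ)`. -/
def mergeRsC : List CtxReqs → Set Constraint
  | [] => ∅
  | R :: Rs => mergeRC R (mergeRs Rs) ∪ mergeRsC Rs

/-- The constraints that two requirements on the same slot impose in case their receivers
coincide. -/
def agree : CReq → CReq → Set Constraint
  | .ext T₁ T₁', .ext T₂ T₂' => {.eqIf T₁' T₂' [.eq T₁ T₂]}
  | .init T₁ Ts₁, .init T₂ Ts₂ => {.eqsIf Ts₁ Ts₂ [.eq T₁ T₂]}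
  | .field T₁ _ T₁', .field T₂ _ T₂' => {.eqIf T₁' T₂' [.eq T₁ T₂]}
  | .method _ T₁ _ Ts₁ T₁', .method _ T₂ _ Ts₂ T₂' =>
      {.eqIf T₁' T₂' [.eq T₁ T₂], .eqsIf Ts₁ Ts₂ [.eq T₁ T₂]}
  | _, _ => ∅

/-- The single requirement into which two requirements on the same slot are merged in case their
receivers coincide: it is the first one, and it is optional only if both are. -/
def combine : CReq → CReq → CReq
  | .method o₁ T m Ts T', .method o₂ _ _ _ _ => .method (o₁ && o₂) T m Ts T'
  | r, _ => r

/-- The requirements of `merge_CR(CR₁, CR₂)`: non-overlapping requirements are kept, overlapping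
ones (those on the same slot) are split according to whether their receivers coincide. -/
def mergeCR (CR₁ CR₂ : ClassReqs) : ClassReqs :=
  {p | p ∈ CR₁ ∧ ∀ q ∈ CR₂, p.1.slot ≠ q.1.slot} ∪
  {q | q ∈ CR₂ ∧ ∀ p ∈ CR₁, p.1.slot ≠ q.1.slot} ∪
  {r | ∃ p ∈ CR₁, ∃ q ∈ CR₂, p.1.slot = q.1.slot ∧
    (r = (p.1, p.2 ++ [.ne p.1.recv q.1.recv]) ∨
     r = (q.1, q.2 ++ [.ne p.1.recv q.1.recv]) ∨
     r = (combine p.1 q.1, p.2 ++ q.2 ++ [.eq p.1.recv q.1.recv]))}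

/-- The constraints of `merge_CR(CR₁, CR₂)`. -/
def mergeCRC (CR₁ CR₂ : ClassReqs) : Set Constraint :=
  {s | ∃ p ∈ CR₁, ∃ q ∈ CR₂, p.1.slot = q.1.slot ∧ s ∈ agree p.1 q.1}

/-- The requirements of `merge_CR(CR₁, ..., CRₙ)`. -/
def mergeCRs : List ClassReqs → ClassReqs
  | [] => ∅
  | CR :: CRs => mergeCR CR (mergeCRs CRs)

/-- The constraints of `merge_CR(CR₁, ..., CRₙ)`. -/
def mergeCRsC : List ClassReqs → Set Constraint
  | [] => ∅
  | CR :: CRs => mergeCRC CR (mergeCRs CRs) ∪ mergeCRsC CRs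

/-! ### Co-contextual typing

The last index of the judgments for expressions and methods is the finite set of the class
variables that are introduced in the derivation; it serves to express freshness. -/

inductive CoHasType :
    Expr → ClassType → Set Constraint → CtxReqs → ClassReqs → Finset ClassVar → Prop
  | var {x : Var} {U : ClassVar} :
      CoHasType (.var x) (.var U) ∅ (CtxReqs.single x (.var U)) ∅ {U}
  | field {e : Expr} {f : FName} {Te : ClassType} {Se : Set Constraint} {Re : CtxReqs}
      {CRe : ClassReqs} {Fe : Finset ClassVar} {U : ClassVar} :
      CoHasType e Te Se Re CRe Fe → U ∉ Fe →
      CoHasType (.field e f) (.var U)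
        (Se ∪ mergeCRC CRe {(.field Te f (.var U), [])})
        Re
        (mergeCR CRe {(.field Te f (.var U), [])})
        (insert U Fe)
  | invk {e : Expr} {m : MName} {es : List Expr}
      {Te : ClassType} {Se : Set Constraint} {Re : CtxReqs} {CRe : ClassReqs}
      {Fe : Finset ClassVar}
      {T : Fin es.length → ClassType} {S : Fin es.length → Set Constraint}
      {R : Fin es.length → CtxReqs} {CR : Fin es.length → ClassReqs}
      {F : Fin es.length → Finset ClassVar}
      {U : Fin es.length → ClassVar} {U' : ClassVar} :
      CoHasType e Te Se Re CRe Fe →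
      (∀ i, CoHasType (es.get i) (T i) (S i) (R i) (CR i) (F i)) →
      (∀ i, Disjoint Fe (F i)) → (∀ i j, i ≠ j → Disjoint (F i) (F j)) →
      U' ∉ Fe → (∀ i, U' ∉ F i) → (∀ i, U i ∉ Fe) → (∀ i j, U i ∉ F j) →
      Function.Injective U → (∀ i, U i ≠ U') →
      CoHasType (.invk e m es) (.var U')
        ((⋃ i, S i) ∪ Se ∪ {s | ∃ i, s = .sub (T i) (.var (U i))} ∪
          mergeRsC (Re :: List.ofFn R) ∪
          mergeCRsC (CRe ::
            {(.method false Te m (List.ofFn fun i => .var (U i)) (.var U'), [])} :: List.ofFn CR))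
        (mergeRs (Re :: List.ofFn R))
        (mergeCRs (CRe ::
          {(.method false Te m (List.ofFn fun i => .var (U i)) (.var U'), [])} :: List.ofFn CR))
        (insert U' (Fe ∪ Finset.univ.biUnion F ∪ Finset.univ.image U))
  | new {C : CName} {es : List Expr}
      {T : Fin es.length → ClassType} {S : Fin es.length → Set Constraint}
      {R : Fin es.length → CtxReqs} {CR : Fin es.length → ClassReqs}
      {F : Fin es.length → Finset ClassVar} {U : Fin es.length → ClassVar} :
      (∀ i, CoHasType (es.get i) (T i) (S i) (R i) (CR i) (F i)) →
      (∀ i j, i ≠ j → Disjoint (F i) (F j)) → (∀ i j, U i ∉ F j) → Function.Injective U →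
      CoHasType (.new C es) (.name C)
        ((⋃ i, S i) ∪ {s | ∃ i, s = .sub (T i) (.var (U i))} ∪
          mergeRsC (List.ofFn R) ∪
          mergeCRsC ({(.init (.name C) (List.ofFn fun i => .var (U i)), [])} :: List.ofFn CR))
        (mergeRs (List.ofFn R))
        (mergeCRs ({(.init (.name C) (List.ofFn fun i => .var (U i)), [])} :: List.ofFn CR))
        (Finset.univ.biUnion F ∪ Finset.univ.image U)
  | ucast {C : CName} {e : Expr} {Te : ClassType} {Se : Set Constraint} {Re : CtxReqs}
      {CRe : ClassReqs} {Fe : Finset ClassVar} :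
      CoHasType e Te Se Re CRe Fe →
      CoHasType (.cast C e) (.name C) (Se ∪ {.sub Te (.name C)}) Re CRe Fe
  | dcast {C : CName} {e : Expr} {Te : ClassType} {Se : Set Constraint} {Re : CtxReqs}
      {CRe : ClassReqs} {Fe : Finset ClassVar} :
      CoHasType e Te Se Re CRe Fe →
      CoHasType (.cast C e) (.name C) (Se ∪ {.sub (.name C) Te} ∪ {.ne (.name C) Te}) Re CRe Fe
  | scast {C : CName} {e : Expr} {Te : ClassType} {Se : Set Constraint} {Re : CtxReqs}
      {CRe : ClassReqs} {Fe : Finset ClassVar} :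
      CoHasType e Te Se Re CRe Fe →
      CoHasType (.cast C e) (.name C) (Se ∪ {.nsub (.name C) Te} ∪ {.nsub Te (.name C)})
        Re CRe Fe

/-- `CoMethodOK M S Uc CR F`: the method declaration `M` is OK co-contextually, with constraints
`S`, the class variable `Uc` for the enclosing class, and class table requirements `CR`. -/
inductive CoMethodOK :
    MethodDecl → Set Constraint → ClassVar → ClassReqs → Finset ClassVar → Prop
  | mk {M : MethodDecl} {Te : ClassType} {Se : Set Constraint} {Re : CtxReqs} {CRe : ClassReqs}
      {Fe : Finset ClassVar} {Uc Ud : ClassVar} :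
      CoHasType M.body Te Se Re CRe Fe →
      M.params.foldl (fun R p => CtxReqs.remove R (.param p.2)) (CtxReqs.remove Re .this)
        = CtxReqs.empty →
      Uc ∉ Fe → Ud ∉ Fe → Uc ≠ Ud →
      CoMethodOK M
        (Se ∪ {.sub Te (.name M.ret)} ∪
          {s | ∃ T, Re .this = some T ∧ s = .eq (.var Uc) T} ∪
          mergeCRsC [CRe, {(.ext (.var Uc) (.var Ud), [])},
            {(.method true (.var Ud) M.name (M.params.map fun p => .name p.1) (.name M.ret), [])}] ∪
          {s | ∃ p ∈ M.params, ∃ T, Re (.param p.2) = some T ∧ s = .eq (.name p.1) T})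
        Uc
        (mergeCRs [CRe, {(.ext (.var Uc) (.var Ud), [])},
          {(.method true (.var Ud) M.name (M.params.map fun p => .name p.1) (.name M.ret), [])}])
        (insert Uc (insert Ud Fe))

/-- `CoClassOK L S CR`: the class declaration `L` is OK co-contextually, with constraints `S` and
class table requirements `CR`. -/
inductive CoClassOK : ClassDecl → Set Constraint → ClassReqs → Prop
  | mk {L : ClassDecl} {Dg Cf : List (CName × FName)}
      {S : Fin L.methods.length → Set Constraint} {U : Fin L.methods.length → ClassVar}
      {CR : Fin L.methods.length → ClassReqs} {F : Fin L.methods.length → Finset ClassVar} :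
      L.CtorForm Dg Cf →
      (∀ i, CoMethodOK (L.methods.get i) (S i) (U i) (CR i) (F i)) →
      (∀ i j, i ≠ j → Disjoint (F i) (F j)) →
      CoClassOK L
        ((⋃ i, S i) ∪ {s | ∃ i, s = .eq (.var (U i)) (.name L.name)} ∪
          mergeCRsC ({(.init (.name L.super) (Dg.map fun p => .name p.1), [])} :: List.ofFn CR))
        (mergeCRs ({(.init (.name L.super) (Dg.map fun p => .name p.1), [])} :: List.ofFn CR))

/-! ### Substitutions and solutions -/

/-- A substitution; a class variable on which it is not defined is mapped to itself. -/
abbrev Subst := ClassVar → ClassType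

def ClassType.subst (σ : Subst) : ClassType → ClassType
  | .name C => .name C
  | .var U => σ U

def CondAtom.subst (σ : Subst) : CondAtom → CondAtom
  | .eq T T' => .eq (T.subst σ) (T'.subst σ)
  | .ne T T' => .ne (T.subst σ) (T'.subst σ)

def CReq.subst (σ : Subst) : CReq → CReq
  | .ext T T' => .ext (T.subst σ) (T'.subst σ)
  | .init T Ts => .init (T.subst σ) (Ts.map (ClassType.subst σ))
  | .field T f T' => .field (T.subst σ) f (T'.subst σ)
  | .method o T m Ts T' => .method o (T.subst σ) m (Ts.map (ClassType.subst σ)) (T'.subst σ)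

/-- `σ(CR)`. -/
def substReqs (σ : Subst) (CR : ClassReqs) : ClassReqs :=
  {p | ∃ q ∈ CR, p = (q.1.subst σ, q.2.map (CondAtom.subst σ))}

def ClassType.Ground (T : ClassType) : Prop := ∃ C, T = .name C

def CondAtom.Ground : CondAtom → Prop
  | .eq T T' => T.Ground ∧ T'.Ground
  | .ne T T' => T.Ground ∧ T'.Ground

def CReq.Ground : CReq → Prop
  | .ext T T' => T.Ground ∧ T'.Ground
  | .init T Ts => T.Ground ∧ ∀ T' ∈ Ts, T'.Ground
  | .field T _ T' => T.Ground ∧ T'.Ground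
  | .method _ T _ Ts T' => T.Ground ∧ (∀ T'' ∈ Ts, T''.Ground) ∧ T'.Ground

def GroundReqs (CR : ClassReqs) : Prop :=
  ∀ p ∈ CR, p.1.Ground ∧ ∀ a ∈ p.2, a.Ground

def CondAtom.Holds : CondAtom → Prop
  | .eq T T' => T = T'
  | .ne T T' => T ≠ T'

def Cond.Holds (cond : Cond) : Prop := ∀ a ∈ cond, a.Holds

/-- Subtyping relative to `Sg` for class types; it only relates class names. -/
def SubType (Sg : Set (CName × CName)) (T T' : ClassType) : Prop :=
  ∃ C D, T = .name C ∧ T' = .name D ∧ SubRel Sg C D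

/-- `sat(Σ, σ, s)`. -/
def Sat (Sg : Set (CName × CName)) (σ : Subst) : Constraint → Prop
  | .eq T T' => T.subst σ = T'.subst σ
  | .ne T T' => T.subst σ ≠ T'.subst σ
  | .sub T T' => SubType Sg (T.subst σ) (T'.subst σ)
  | .nsub T T' => ¬ SubType Sg (T.subst σ) (T'.subst σ)
  | .eqIf T T' cond =>
      Cond.Holds (cond.map (CondAtom.subst σ)) → T.subst σ = T'.subst σ
  | .eqsIf Ts Ts' cond =>
      Cond.Holds (cond.map (CondAtom.subst σ)) →
        Ts.map (ClassType.subst σ) = Ts'.map (ClassType.subst σ)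

/-- `σ` is a solution of the constraints `S` relative to `Sg`. -/
def Solves (Sg : Set (CName × CName)) (S : Set Constraint) (σ : Subst) : Prop :=
  ∀ s ∈ S, Sat Sg σ s

/-! ### Satisfaction of requirements by class tables -/

/-- The class table satisfies a (ground) class requirement. -/
inductive ClassTable.SatisfiesReq (CT : ClassTable) : CReq → Prop
  | ext {C D : CName} : CT.Extends C D → CT.SatisfiesReq (.ext (.name C) (.name D))
  | init {C : CName} {Cs : List CName} : CT.Fields C Cs →
      CT.SatisfiesReq (.init (.name C) (Cs.map .name))
  | field {C C' : CName} {f : FName} : CT.Field f C C' →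
      CT.SatisfiesReq (.field (.name C) f (.name C'))
  | method {C C' : CName} {m : MName} {Cs : List CName} : CT.MType m C Cs C' →
      CT.SatisfiesReq (.method false (.name C) m (Cs.map .name) (.name C'))
  | optMethod {C C' : CName} {m : MName} {Cs : List CName} :
      (∀ Ds D', CT.MType m C Ds D' → Ds = Cs ∧ D' = C') →
      CT.SatisfiesReq (.method true (.name C) m (Cs.map .name) (.name C'))

/-- The class table satisfies every requirement whose condition holds. -/
def ClassTable.Satisfies (CT : ClassTable) (CR : ClassReqs) : Prop :=
  ∀ p ∈ CR, Cond.Holds p.2 → CT.SatisfiesReq p.1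

end FJ

/-! The class table is read off from the solution: keep the `extends` clauses of `CT₀`, drop all its
other clauses, which might clash with what `CR` asks for, and add for every requirement in `σ(CR)`
the clause stating it literally. Clauses are added even for optional requirements and for those
whose condition fails. Every requirement is then met by a declaration in the receiver itself, so no
lookup ever has to climb to a superclass; for an optional requirement the local declaration likewise
decides what lookup can return.

What has to be shown is that these clauses form a class table with the right inheritance relation.
This is the invariant `Coherent`, preserved by each merge (`Coherent.mergeCR`) and hence valid for
whole derivations. Consistency comes from the constraints emitted by merging, which force two
requirements on the same slot and receiver to agree up to optionality; it gives uniqueness of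
clauses. Liveness is needed because the inheritance hypothesis speaks only of requirements whose
condition holds: a dead `extends` requirement has a live counterpart with the same slot and
receiver, by consistency it yields the same clause, and so it adds no new pair to `Σ`. Finiteness of
`CR` makes the table finite. All this is assembled in `Coherent.exists_classTable`.

Soundness (`CoHasType.hasType`, `CoMethodOK.methodOK`, `CoClassOK.classOK`) is then an induction on
derivations. Since the table satisfies all requirements regardless of conditions, and merging only
adds conditions to the given requirements without discarding any, each subderivation sees its own
requirements satisfied. -/

namespace FJ

/-! ### Contents of merged requirements -/

/-- The requirement with its optionality forgotten. -/
def CReq.strict : CReq → CReq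
  | .method _ T m Ts T' => .method false T m Ts T'
  | r => r

theorem combine_slot (p q : CReq) : (combine p q).slot = p.slot := by
  cases p <;> cases q <;> rfl

theorem combine_recv (p q : CReq) : (combine p q).recv = p.recv := by
  cases p <;> cases q <;> rfl

theorem combine_strict (σ : Subst) (p q : CReq) :
    ((combine p q).subst σ).strict = (p.subst σ).strict := by
  cases p <;> cases q <;> rfl

theorem CReq.subst_recv (σ : Subst) (p : CReq) : (p.subst σ).recv = p.recv.subst σ := by
  cases p <;> rfl

theorem CReq.subst_slot (σ : Subst) (p : CReq) : (p.subst σ).slot = p.slot := by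
  cases p <;> rfl

/-- If the constraints on two overlapping requirements with equal receivers are satisfied, then
the requirements coincide up to optionality. -/
theorem strict_eq_of_agree {Sg : Set (CName × CName)} {σ : Subst} {p q : CReq}
    (hs : p.slot = q.slot) (hr : p.recv.subst σ = q.recv.subst σ)
    (h : Solves Sg (agree p q) σ) : (p.subst σ).strict = (q.subst σ).strict := by
  cases p <;> cases q <;>
    simp_all [CReq.slot, CReq.recv, agree, Solves, Sat, CReq.subst, CReq.strict, Cond.Holds,
      CondAtom.subst, CondAtom.Holds]

/-- An overlapping requirement survives in the copy guarded by distinct receivers, so a property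
that ignores conditions passes from a merge back to its parts. This is how satisfaction descends to
subterms. -/
theorem forall_left_of_mergeCR {P : CReq → Prop} {A B : ClassReqs}
    (h : ∀ p ∈ mergeCR A B, P p.1) : ∀ p ∈ A, P p.1 := by
  intro p hp
  by_cases hq : ∀ q ∈ B, p.1.slot ≠ q.1.slot
  · exact h p (Or.inl (Or.inl ⟨hp, hq⟩))
  · push Not at hq
    obtain ⟨q, hq, hs⟩ := hq
    exact h (p.1, p.2 ++ [.ne p.1.recv q.1.recv]) (Or.inr ⟨p, hp, q, hq, hs, Or.inl rfl⟩)

theorem forall_right_of_mergeCR {P : CReq → Prop} {A B : ClassReqs}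
    (h : ∀ p ∈ mergeCR A B, P p.1) : ∀ q ∈ B, P q.1 := by
  intro q hq
  by_cases hp : ∀ p ∈ A, p.1.slot ≠ q.1.slot
  · exact h q (Or.inl (Or.inr ⟨hq, hp⟩))
  · push Not at hp
    obtain ⟨p, hp, hs⟩ := hp
    exact h (q.1, q.2 ++ [.ne p.1.recv q.1.recv])
      (Or.inr ⟨p, hp, q, hq, hs, Or.inr (Or.inl rfl)⟩)

theorem forall_of_mergeCRs {P : CReq → Prop} {l : List ClassReqs}
    (h : ∀ p ∈ mergeCRs l, P p.1) : ∀ CR ∈ l, ∀ p ∈ CR, P p.1 := by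
  induction l with
  | nil => simp
  | cons A l ih =>
    simp only [List.mem_cons, forall_eq_or_imp]
    exact ⟨forall_left_of_mergeCR h, ih (forall_right_of_mergeCR h)⟩

/-! ### Coherence of requirements -/

/-- Up to optionality, requirements on the same slot with equal receivers coincide under `σ`, and
every requirement has a counterpart whose condition holds. -/
structure Coherent (σ : Subst) (CR : ClassReqs) : Prop where
  finite : CR.Finite
  consistent : ∀ p ∈ CR, ∀ q ∈ CR, p.1.slot = q.1.slot →
    p.1.recv.subst σ = q.1.recv.subst σ → (p.1.subst σ).strict = (q.1.subst σ).strict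
  live : ∀ p ∈ CR, ∃ q ∈ CR, q.1.slot = p.1.slot ∧ q.1.recv.subst σ = p.1.recv.subst σ ∧
    Cond.Holds (q.2.map (CondAtom.subst σ))

theorem Coherent.empty (σ : Subst) : Coherent σ ∅ := ⟨Set.finite_empty, by simp, by simp⟩

theorem Coherent.singleton (σ : Subst) (r : CReq) : Coherent σ {(r, [])} :=
  ⟨Set.finite_singleton _, by simp, by simp [Cond.Holds]⟩

/-- Every merged requirement stems from one of the two merged sets. -/
theorem exists_origin_of_mem_mergeCR {A B : ClassReqs} (σ : Subst) {r : CReq × Cond}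
    (hr : r ∈ mergeCR A B) : ∃ p, (p ∈ A ∨ p ∈ B) ∧ r.1.slot = p.1.slot ∧ r.1.recv = p.1.recv ∧
      (r.1.subst σ).strict = (p.1.subst σ).strict := by
  rcases hr with (⟨h, -⟩ | ⟨h, -⟩) | ⟨p, hp, q, hq, -, rfl | rfl | rfl⟩
  · exact ⟨r, Or.inl h, rfl, rfl, rfl⟩
  · exact ⟨r, Or.inr h, rfl, rfl, rfl⟩
  · exact ⟨p, Or.inl hp, rfl, rfl, rfl⟩
  · exact ⟨q, Or.inr hq, rfl, rfl, rfl⟩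
  · exact ⟨p, Or.inl hp, combine_slot _ _, combine_recv _ _, combine_strict _ _ _⟩

theorem finite_mergeCR {A B : ClassReqs} (hA : A.Finite) (hB : B.Finite) :
    (mergeCR A B).Finite := by
  refine ((hA.subset fun p h => h.1).union (hB.subset fun p h => h.1)).union ?_
  have h1 := hA.prod hB
  refine (((h1.image fun x => (x.1.1, x.1.2 ++ [CondAtom.ne x.1.1.recv x.2.1.recv])).union
    (h1.image fun x => (x.2.1, x.2.2 ++ [CondAtom.ne x.1.1.recv x.2.1.recv]))).union
    (h1.image fun x =>
      (combine x.1.1 x.2.1, x.1.2 ++ x.2.2 ++ [CondAtom.eq x.1.1.recv x.2.1.recv]))).subset ?_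
  rintro r ⟨p, hp, q, hq, -, rfl | rfl | rfl⟩
  · exact Or.inl (Or.inl ⟨(p, q), ⟨hp, hq⟩, rfl⟩)
  · exact Or.inl (Or.inr ⟨(p, q), ⟨hp, hq⟩, rfl⟩)
  · exact Or.inr ⟨(p, q), ⟨hp, hq⟩, rfl⟩

theorem holds_append (c d : Cond) : Cond.Holds (c ++ d) ↔ c.Holds ∧ d.Holds := by
  simp [Cond.Holds, or_imp, forall_and]

theorem holds_singleton (a : CondAtom) : Cond.Holds [a] ↔ a.Holds := by
  simp [Cond.Holds]

/-- Two live overlapping requirements each leave a live merged requirement. -/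
theorem exists_live_of_overlap {A B : ClassReqs} {σ : Subst} {p q : CReq × Cond} (hp : p ∈ A)
    (hq : q ∈ B) (hs : p.1.slot = q.1.slot) (hpl : Cond.Holds (p.2.map (CondAtom.subst σ)))
    (hql : Cond.Holds (q.2.map (CondAtom.subst σ))) :
    (∃ r ∈ mergeCR A B, r.1.slot = p.1.slot ∧ r.1.recv.subst σ = p.1.recv.subst σ ∧
      Cond.Holds (r.2.map (CondAtom.subst σ))) ∧
    ∃ r ∈ mergeCR A B, r.1.slot = q.1.slot ∧ r.1.recv.subst σ = q.1.recv.subst σ ∧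
      Cond.Holds (r.2.map (CondAtom.subst σ)) := by
  by_cases hr : p.1.recv.subst σ = q.1.recv.subst σ
  · have hm : (combine p.1 q.1, p.2 ++ q.2 ++ [CondAtom.eq p.1.recv q.1.recv]) ∈ mergeCR A B :=
      Or.inr ⟨p, hp, q, hq, hs, Or.inr (Or.inr rfl)⟩
    have hl : Cond.Holds ((p.2 ++ q.2 ++ [CondAtom.eq p.1.recv q.1.recv]).map (CondAtom.subst σ)) := by
      simp only [List.map_append, List.map_cons, List.map_nil, holds_append, holds_singleton]
      exact ⟨⟨hpl, hql⟩, hr⟩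
    exact ⟨⟨_, hm, combine_slot _ _, by rw [combine_recv], hl⟩,
      ⟨_, hm, (combine_slot _ _).trans hs, by rw [combine_recv, hr], hl⟩⟩
  -- With distinct receivers, the two copies guarded by `≠` are live; with equal receivers it was
  -- the combined requirement that served for both.
  · refine ⟨⟨_, Or.inr ⟨p, hp, q, hq, hs, Or.inl rfl⟩, rfl, rfl, ?_⟩,
      ⟨_, Or.inr ⟨p, hp, q, hq, hs, Or.inr (Or.inl rfl)⟩, rfl, rfl, ?_⟩⟩ <;>
    simp only [List.map_append, List.map_cons, List.map_nil, holds_append, holds_singleton]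
    · exact ⟨hpl, hr⟩
    · exact ⟨hql, hr⟩

/-- Consistency needs an argument only across the two sets, where the constraints of the merge
apply; conditions play no role in it. For liveness, a live representative is followed through the
merge. -/
theorem Coherent.mergeCR {Sg : Set (CName × CName)} {σ : Subst} {A B : ClassReqs}
    (hA : Coherent σ A) (hB : Coherent σ B) (h : Solves Sg (mergeCRC A B) σ) :
    Coherent σ (mergeCR A B) := by
  refine ⟨finite_mergeCR hA.finite hB.finite, ?_, ?_⟩
  · have hAB : ∀ p ∈ A, ∀ q ∈ B, p.1.slot = q.1.slot →
        p.1.recv.subst σ = q.1.recv.subst σ → (p.1.subst σ).strict = (q.1.subst σ).strict :=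
      fun p hp q hq hs hr =>
        strict_eq_of_agree hs hr fun s hsm => h s ⟨p, hp, q, hq, hs, hsm⟩
    intro r₁ h₁ r₂ h₂ hs hr
    obtain ⟨p, hp, ps, pr, pe⟩ := exists_origin_of_mem_mergeCR σ h₁
    obtain ⟨q, hq, qs, qr, qe⟩ := exists_origin_of_mem_mergeCR σ h₂
    rw [ps, qs] at hs
    rw [pr, qr] at hr
    rw [pe, qe]
    rcases hp with hp | hp <;> rcases hq with hq | hq
    · exact hA.consistent p hp q hq hs hr
    · exact hAB p hp q hq hs hr
    · exact (hAB q hq p hp hs.symm hr.symm).symm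
    · exact hB.consistent p hp q hq hs hr
  · intro r hr
    obtain ⟨p, hp, ps, pr, -⟩ := exists_origin_of_mem_mergeCR σ hr
    rw [ps, pr]
    rcases hp with hp | hp
    · obtain ⟨p', hp', hs, hr, hl⟩ := hA.live p hp
      rw [← hs, ← hr]
      by_cases hq : ∀ q ∈ B, p'.1.slot ≠ q.1.slot
      · exact ⟨p', Or.inl (Or.inl ⟨hp', hq⟩), rfl, rfl, hl⟩
      · push Not at hq
        -- The overlapping `q` may be dead, and the combined requirement inherits its condition; it
        -- is therefore replaced by a live counterpart on the same slot.
        obtain ⟨q, hq, hqs⟩ := hq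
        obtain ⟨q', hq', hqs', -, hql⟩ := hB.live q hq
        exact (exists_live_of_overlap hp' hq' (hqs.trans hqs'.symm) hl hql).1
    · obtain ⟨p', hp', hs, hr, hl⟩ := hB.live p hp
      rw [← hs, ← hr]
      by_cases hq : ∀ q ∈ A, q.1.slot ≠ p'.1.slot
      · exact ⟨p', Or.inl (Or.inr ⟨hp', hq⟩), rfl, rfl, hl⟩
      · push Not at hq
        obtain ⟨q, hq, hqs⟩ := hq
        obtain ⟨q', hq', hqs', -, hql⟩ := hA.live q hq
        exact (exists_live_of_overlap hq' hp' (hqs'.trans hqs) hql hl).2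

theorem solves_union {Sg : Set (CName × CName)} {S S' : Set Constraint} {σ : Subst} :
    Solves Sg (S ∪ S') σ ↔ Solves Sg S σ ∧ Solves Sg S' σ := by
  simp [Solves, or_imp, forall_and]

theorem solves_iUnion {ι : Type*} {Sg : Set (CName × CName)} {S : ι → Set Constraint} {σ : Subst} :
    Solves Sg (⋃ i, S i) σ ↔ ∀ i, Solves Sg (S i) σ := by
  simp only [Solves, Set.mem_iUnion, forall_exists_index]
  exact forall_comm

theorem Coherent.mergeCRs {Sg : Set (CName × CName)} {σ : Subst} {l : List ClassReqs}
    (hl : ∀ CR ∈ l, Coherent σ CR) (h : Solves Sg (mergeCRsC l) σ) :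
    Coherent σ (mergeCRs l) := by
  induction l with
  | nil => exact Coherent.empty σ
  | cons A l ih =>
    obtain ⟨h₁, h₂⟩ := solves_union.1 h
    exact (hl A (by simp)).mergeCR (ih (fun CR hCR => hl CR (by simp [hCR])) h₂) h₁

theorem CoHasType.coherent {Sg : Set (CName × CName)} {σ : Subst} {e : Expr} {T : ClassType}
    {S : Set Constraint} {R : CtxReqs} {CR : ClassReqs} {F : Finset ClassVar}
    (he : CoHasType e T S R CR F) (h : Solves Sg S σ) : Coherent σ CR := by
  induction he with
  | var => exact Coherent.empty σ
  | field _ _ ih =>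
    obtain ⟨h₁, h₂⟩ := solves_union.1 h
    exact (ih h₁).mergeCR (Coherent.singleton σ _) h₂
  | invk _ _ _ _ _ _ _ _ _ _ ih ihs =>
    simp only [solves_union, solves_iUnion] at h
    refine Coherent.mergeCRs ?_ h.2
    simp only [List.mem_cons, List.mem_ofFn, forall_eq_or_imp, forall_exists_index,
      forall_apply_eq_imp_iff]
    exact ⟨ih h.1.1.1.2, Coherent.singleton σ _, fun i => ihs i (h.1.1.1.1 i)⟩
  | new _ _ _ _ ihs =>
    simp only [solves_union, solves_iUnion] at h
    refine Coherent.mergeCRs ?_ h.2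
    simp only [List.mem_cons, List.mem_ofFn, forall_eq_or_imp, forall_exists_index,
      forall_apply_eq_imp_iff]
    exact ⟨Coherent.singleton σ _, fun i => ihs i (h.1.1.1 i)⟩
  | ucast _ ih => exact ih (solves_union.1 h).1
  | dcast _ ih => exact ih (solves_union.1 (solves_union.1 h).1).1
  | scast _ ih => exact ih (solves_union.1 (solves_union.1 h).1).1

theorem CoMethodOK.coherent {Sg : Set (CName × CName)} {σ : Subst} {M : MethodDecl}
    {S : Set Constraint} {U : ClassVar} {CR : ClassReqs} {F : Finset ClassVar}
    (hM : CoMethodOK M S U CR F) (h : Solves Sg S σ) : Coherent σ CR := by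
  obtain ⟨he, -, -, -, -⟩ := hM
  simp only [solves_union] at h
  refine Coherent.mergeCRs ?_ h.1.2
  simp only [List.mem_cons, List.not_mem_nil, or_false, forall_eq_or_imp, forall_eq]
  exact ⟨he.coherent h.1.1.1.1, Coherent.singleton σ _, Coherent.singleton σ _⟩

theorem CoClassOK.coherent {Sg : Set (CName × CName)} {σ : Subst} {L : ClassDecl}
    {S : Set Constraint} {CR : ClassReqs} (hL : CoClassOK L S CR) (h : Solves Sg S σ) :
    Coherent σ CR := by
  obtain ⟨-, hM, -⟩ := hL
  simp only [solves_union, solves_iUnion] at h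
  refine Coherent.mergeCRs ?_ h.2
  simp only [List.mem_cons, List.mem_ofFn, forall_eq_or_imp, forall_exists_index,
    forall_apply_eq_imp_iff]
  exact ⟨Coherent.singleton σ _, fun i => (hM i).coherent (h.1.1 i)⟩

/-! ### Soundness of co-contextual typing -/

/-- The context `Γ` meets the context requirements `R` under `σ`. -/
def Meets (σ : Subst) (Γ : Ctx) (R : CtxReqs) : Prop :=
  ∀ x T, R x = some T → ∃ C, T.subst σ = .name C ∧ Γ x = some C

/-- The merge keeps the left type of a variable bound on both sides; the emitted equality transfers
the bound to the right type. -/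
theorem Meets.of_mergeR {Sg : Set (CName × CName)} {σ : Subst} {Γ : Ctx} {R₁ R₂ : CtxReqs}
    (h : Meets σ Γ (mergeR R₁ R₂)) (hs : Solves Sg (mergeRC R₁ R₂) σ) :
    Meets σ Γ R₁ ∧ Meets σ Γ R₂ := by
  refine ⟨fun x T hT => h x T (by simp [mergeR, hT]), fun x T hT => ?_⟩
  cases h₁ : R₁ x with
  | none => exact h x T (by simp [mergeR, h₁, hT])
  | some T₁ =>
    have he : T₁.subst σ = T.subst σ := hs _ ⟨x, T₁, T, h₁, hT, rfl⟩
    rw [← he]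
    exact h x T₁ (by simp [mergeR, h₁])

theorem Meets.of_mergeRs {Sg : Set (CName × CName)} {σ : Subst} {Γ : Ctx} {l : List CtxReqs}
    (h : Meets σ Γ (mergeRs l)) (hs : Solves Sg (mergeRsC l) σ) : ∀ R ∈ l, Meets σ Γ R := by
  induction l with
  | nil => simp
  | cons A l ih =>
    obtain ⟨h₁, h₂⟩ := solves_union.1 hs
    obtain ⟨hA, hB⟩ := h.of_mergeR h₁
    simp only [List.mem_cons, forall_eq_or_imp]
    exact ⟨hA, ih hB h₂⟩

theorem map_name_injective : Function.Injective (List.map ClassType.name) :=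
  List.map_injective_iff.2 fun _ _ h => ClassType.name.inj h

theorem satisfiesReq_ext {CT : ClassTable} {T T' : ClassType}
    (h : CT.SatisfiesReq (.ext T T')) : ∃ C D, T = .name C ∧ T' = .name D ∧ CT.Extends C D := by
  cases h with
  | ext h => exact ⟨_, _, rfl, rfl, h⟩

theorem satisfiesReq_field {CT : ClassTable} {T T' : ClassType} {f : FName}
    (h : CT.SatisfiesReq (.field T f T')) :
    ∃ C C', T = .name C ∧ T' = .name C' ∧ CT.Field f C C' := by
  cases h with
  | field h => exact ⟨_, _, rfl, rfl, h⟩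

theorem satisfiesReq_init {CT : ClassTable} {C : CName} {Cs : List CName}
    (h : CT.SatisfiesReq (.init (.name C) (Cs.map .name))) : CT.Fields C Cs := by
  generalize hT : Cs.map ClassType.name = Ts at h
  cases h with
  | init h => rwa [map_name_injective hT]

theorem satisfiesReq_method {CT : ClassTable} {T T' : ClassType} {m : MName} {Cs : List CName}
    (h : CT.SatisfiesReq (.method false T m (Cs.map .name) T')) :
    ∃ C C', T = .name C ∧ T' = .name C' ∧ CT.MType m C Cs C' := by
  generalize hT : Cs.map ClassType.name = Ts at h
  cases h with
  | method h => exact ⟨_, _, rfl, rfl, map_name_injective hT ▸ h⟩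

theorem satisfiesReq_optMethod {CT : ClassTable} {C C' : CName} {m : MName} {Cs : List CName}
    (h : CT.SatisfiesReq (.method true (.name C) m (Cs.map .name) (.name C'))) :
    ∀ Ds D', CT.MType m C Ds D' → Ds = Cs ∧ D' = C' := by
  generalize hT : Cs.map ClassType.name = Ts at h
  cases h with
  | optMethod h => rwa [map_name_injective hT]

theorem CoHasType.hasType {CT : ClassTable} {σ : Subst} {Γ : Ctx} {e : Expr} {T : ClassType}
    {S : Set Constraint} {R : CtxReqs} {CR : ClassReqs} {F : Finset ClassVar}
    (he : CoHasType e T S R CR F) (h : Solves CT.ext S σ) (hΓ : Meets σ Γ R)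
    (hCR : ∀ p ∈ CR, CT.SatisfiesReq (p.1.subst σ)) :
    ∃ C, T.subst σ = .name C ∧ HasType CT Γ e C := by
  induction he with
  | @var x U =>
    obtain ⟨C, hC, hx⟩ := hΓ x (.var U) (by simp [CtxReqs.single])
    exact ⟨C, hC, .var hx⟩
  | field _ _ ih =>
    have hP := forall_left_of_mergeCR (P := fun r => CT.SatisfiesReq (r.subst σ)) hCR
    have hf := forall_right_of_mergeCR (P := fun r => CT.SatisfiesReq (r.subst σ)) hCR _ rfl
    obtain ⟨C, hC, ht⟩ := ih (solves_union.1 h).1 hΓ hP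
    obtain ⟨C₁, C', h₁, h₂, hfd⟩ := satisfiesReq_field hf
    obtain rfl : C = C₁ := ClassType.name.inj (hC.symm.trans h₁)
    exact ⟨C', h₂, .field ht hfd⟩
  | @invk e m es Te Se Re CRe Fe T S R CR F U U' _ _ _ _ _ _ _ _ _ _ ih ihs =>
    simp only [solves_union, solves_iUnion] at h
    obtain ⟨⟨⟨⟨hS, hSe⟩, hsub⟩, hR⟩, -⟩ := h
    have hΓs := hΓ.of_mergeRs hR
    have hP := forall_of_mergeCRs (P := fun r => CT.SatisfiesReq (r.subst σ)) hCR
    simp only [List.mem_cons, List.mem_ofFn, forall_eq_or_imp, forall_exists_index,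
      forall_apply_eq_imp_iff] at hΓs hP
    obtain ⟨hPe, hPm, hPs⟩ := hP
    obtain ⟨Ce, hCe, hte⟩ := ih hSe hΓs.1 hPe
    choose Cs hCs hts using fun i => ihs i (hS i) (hΓs.2 i) (hPs i)
    -- Subtyping relates class names only, so solving these constraints already makes the parameter
    -- types ground.
    have hsub' : ∀ i, ∃ D, σ (U i) = .name D ∧ CT.Sub (Cs i) D := by
      intro i
      obtain ⟨C, D, hC, hD, hCD⟩ := hsub _ ⟨i, rfl⟩
      obtain rfl : Cs i = C := ClassType.name.inj ((hCs i).symm.trans hC)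
      exact ⟨D, hD, hCD⟩
    choose Ds hDs hCD using hsub'
    have hm := hPm _ rfl
    have hUs : (List.ofFn fun i => ClassType.var (U i)).map (ClassType.subst σ)
        = (List.ofFn Ds).map .name := by
      simp only [List.map_ofFn]
      congr 1
      funext i
      exact hDs i
    simp only [CReq.subst, hUs] at hm
    obtain ⟨C₁, C', h₁, h₂, hmt⟩ := satisfiesReq_method hm
    obtain rfl : Ce = C₁ := ClassType.name.inj (hCe.symm.trans h₁)
    exact ⟨C', h₂, .invk hte hts hmt hCD⟩
  | @new C es T S R CR F U _ _ _ _ ihs =>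
    simp only [solves_union, solves_iUnion] at h
    obtain ⟨⟨⟨hS, hsub⟩, hR⟩, -⟩ := h
    have hΓs := hΓ.of_mergeRs hR
    have hP := forall_of_mergeCRs (P := fun r => CT.SatisfiesReq (r.subst σ)) hCR
    simp only [List.mem_cons, List.mem_ofFn, forall_eq_or_imp, forall_exists_index,
      forall_apply_eq_imp_iff] at hΓs hP
    obtain ⟨hPm, hPs⟩ := hP
    choose Cs hCs hts using fun i => ihs i (hS i) (hΓs i) (hPs i)
    have hsub' : ∀ i, ∃ D, σ (U i) = .name D ∧ CT.Sub (Cs i) D := by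
      intro i
      obtain ⟨C, D, hC, hD, hCD⟩ := hsub _ ⟨i, rfl⟩
      obtain rfl : Cs i = C := ClassType.name.inj ((hCs i).symm.trans hC)
      exact ⟨D, hD, hCD⟩
    choose Ds hDs hCD using hsub'
    have hm := hPm _ rfl
    have hUs : (List.ofFn fun i => ClassType.var (U i)).map (ClassType.subst σ)
        = (List.ofFn Ds).map .name := by
      simp only [List.map_ofFn]
      congr 1
      funext i
      exact hDs i
    simp only [CReq.subst, hUs] at hm
    exact ⟨C, rfl, .new hts (satisfiesReq_init hm) hCD⟩
  | @ucast C e Te Se Re CRe Fe _ ih =>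
    obtain ⟨h₁, h₂⟩ := solves_union.1 h
    obtain ⟨D, hD, ht⟩ := ih h₁ hΓ hCR
    obtain ⟨D', C', hD', hC', hsub⟩ := h₂ _ rfl
    obtain rfl : D = D' := ClassType.name.inj (hD.symm.trans hD')
    obtain rfl : C = C' := ClassType.name.inj hC'
    exact ⟨C, rfl, .ucast ht hsub⟩
  | @dcast C e Te Se Re CRe Fe _ ih =>
    simp only [solves_union] at h
    obtain ⟨⟨h₁, h₂⟩, h₃⟩ := h
    obtain ⟨D, hD, ht⟩ := ih h₁ hΓ hCR
    obtain ⟨C', D', hC', hD', hsub⟩ := h₂ _ rfl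
    obtain rfl : D = D' := ClassType.name.inj (hD.symm.trans hD')
    obtain rfl : C = C' := ClassType.name.inj hC'
    exact ⟨C, rfl, .dcast ht hsub fun hCD => h₃ _ rfl (hCD ▸ hD.symm)⟩
  | @scast C e Te Se Re CRe Fe _ ih =>
    simp only [solves_union] at h
    obtain ⟨⟨h₁, h₂⟩, h₃⟩ := h
    obtain ⟨D, hD, ht⟩ := ih h₁ hΓ hCR
    exact ⟨C, rfl, .scast ht (fun hs => h₂ _ rfl ⟨C, D, rfl, hD, hs⟩)
      fun hs => h₃ _ rfl ⟨D, C, hD, rfl, hs⟩⟩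

theorem foldl_remove_param_apply (l : List (CName × ℕ)) (R : CtxReqs) (x : Var)
    (hx : ∀ p ∈ l, x ≠ .param p.2) :
    l.foldl (fun R p => CtxReqs.remove R (.param p.2)) R x = R x := by
  induction l generalizing R with
  | nil => rfl
  | cons p l ih =>
    rw [List.foldl_cons, ih _ fun q hq => hx q (by simp [hq])]
    simp [CtxReqs.remove, hx p (by simp)]

theorem CoMethodOK.methodOK {CT : ClassTable} {σ : Subst} {M : MethodDecl} {C : CName}
    {S : Set Constraint} {U : ClassVar} {CR : ClassReqs} {F : Finset ClassVar}
    (hM : CoMethodOK M S U CR F) (h : Solves CT.ext S σ) (hU : σ U = .name C)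
    (hCR : ∀ p ∈ CR, CT.SatisfiesReq (p.1.subst σ)) : MethodOK CT C M := by
  obtain @⟨Te, Se, Re, CRe, Fe, _, Ud, he, hempty, -, -, -⟩ := hM
  simp only [solves_union] at h
  obtain ⟨⟨⟨⟨hSe, hret⟩, hthis⟩, -⟩, hpar⟩ := h
  have hP := forall_of_mergeCRs (P := fun r => CT.SatisfiesReq (r.subst σ)) hCR
  simp only [List.mem_cons, List.not_mem_nil, or_false, forall_eq_or_imp, forall_eq] at hP
  obtain ⟨hPe, hPx, hPo⟩ := hP
  replace hPx := hPx _ rfl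
  replace hPo := hPo _ rfl
  have hΓ : Meets σ (methodCtx M.params C) Re := by
    intro x T hT
    cases x with
    | this => exact ⟨C, (hthis _ ⟨T, hT, rfl⟩).symm.trans hU, rfl⟩
    | param n =>
      -- A required variable outside the parameter list would survive the removals, which leave
      -- nothing.
      by_cases hn : ∀ p ∈ M.params, Var.param n ≠ .param p.2
      · have h₀ := foldl_remove_param_apply M.params (CtxReqs.remove Re .this) _ hn
        rw [hempty] at h₀
        simp [CtxReqs.empty, CtxReqs.remove, hT] at h₀
      · push Not at hn
        obtain ⟨p, hp, hnp⟩ := hn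
        have hf : (M.params.find? fun p => p.2 = n).isSome := by
          rw [List.find?_isSome]
          exact ⟨p, hp, by simpa using (Var.param.inj hnp).symm⟩
        obtain ⟨q, hq⟩ := Option.isSome_iff_exists.1 hf
        have hqn : q.2 = n := by simpa using List.find?_some hq
        -- Should a parameter name be repeated, the context takes its first occurrence; the
        -- constraints cover every occurrence, hence this one.
        refine ⟨q.1, (hpar _ ⟨q, List.mem_of_find?_eq_some hq, T, hqn ▸ hT, rfl⟩).symm, ?_⟩
        simp [methodCtx, hq]
  obtain ⟨E, hE, ht⟩ := he.hasType hSe hΓ hPe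
  obtain ⟨E', D', hE', hD', hsub⟩ := hret _ rfl
  obtain rfl : E = E' := ClassType.name.inj (hE.symm.trans hE')
  obtain rfl : M.ret = D' := ClassType.name.inj hD'
  obtain ⟨C₁, D, hC₁, hD, hext⟩ := satisfiesReq_ext hPx
  obtain rfl : C = C₁ := ClassType.name.inj (hU.symm.trans hC₁)
  refine ⟨⟨E, ht, hsub⟩, D, hext, fun Ds D₀ hmt => ?_⟩
  have hps : (M.params.map fun p => ClassType.name p.1).map (ClassType.subst σ)
      = (M.params.map Prod.fst).map .name := by
    simp [ClassType.subst]
  have hDσ : (ClassType.var Ud).subst σ = .name D := hD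
  simp only [CReq.subst, hps, hDσ] at hPo
  obtain ⟨h₁, h₂⟩ := satisfiesReq_optMethod hPo Ds D₀ hmt
  exact ⟨h₁.symm, h₂.symm⟩

theorem CoClassOK.classOK {CT : ClassTable} {σ : Subst} {L : ClassDecl} {S : Set Constraint}
    {CR : ClassReqs} (hL : CoClassOK L S CR) (h : Solves CT.ext S σ)
    (hCR : ∀ p ∈ CR, CT.SatisfiesReq (p.1.subst σ)) : ClassOK CT L := by
  obtain @⟨Dg, Cf, S, U, CR, F, hform, hM, -⟩ := hL
  simp only [solves_union, solves_iUnion] at h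
  obtain ⟨⟨hS, hU⟩, -⟩ := h
  have hP := forall_of_mergeCRs (P := fun r => CT.SatisfiesReq (r.subst σ)) hCR
  simp only [List.mem_cons, List.mem_ofFn, forall_eq_or_imp, forall_exists_index,
    forall_apply_eq_imp_iff] at hP
  obtain ⟨hPi, hPs⟩ := hP
  refine ⟨Dg, Cf, hform, satisfiesReq_init ?_, fun M hm => ?_⟩
  · simpa [CReq.subst, ClassType.subst, Function.comp_def] using hPi _ rfl
  · obtain ⟨i, rfl⟩ := List.get_of_mem hm
    exact (hM i).methodOK (hS i) (hU _ ⟨i, rfl⟩) (hPs i)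

/-! ### The class table of a ground solution -/

/-- The name of a ground class type; class variables get an arbitrary value. -/
def ClassType.toName : ClassType → CName
  | .name C => C
  | .var _ => 0

/-- The clause that literally grants a ground requirement. -/
def CReq.toClause : CReq → Clause
  | .ext T T' => .ext T.toName T'.toName
  | .init T Ts => .init T.toName (Ts.map ClassType.toName)
  | .field T f T' => .field T.toName f T'.toName
  | .method _ T m Ts T' => .method T.toName m (Ts.map ClassType.toName) T'.toName

theorem CReq.toClause_strict (r : CReq) : r.strict.toClause = r.toClause := by
  cases r <;> rfl

theorem CReq.dom_toClause (r : CReq) : r.toClause.dom = (r.recv.toName, r.slot) := by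
  cases r <;> rfl

theorem ClassType.Ground.name_toName {T : ClassType} (h : T.Ground) : .name T.toName = T := by
  obtain ⟨C, rfl⟩ := h
  rfl

theorem CReq.Ground.recv {r : CReq} (h : r.Ground) : r.recv.Ground := by
  cases r <;> exact h.1

theorem map_name_toName {Ts : List ClassType} (h : ∀ T ∈ Ts, T.Ground) :
    (Ts.map ClassType.toName).map .name = Ts := by
  rw [List.map_map]
  exact (List.map_congr_left fun T hT => (h T hT).name_toName).trans (List.map_id Ts)

/-- A class table that contains the clause of a ground requirement satisfies the requirement. -/
theorem satisfiesReq_of_toClause_mem {CT : ClassTable} {r : CReq} (hg : r.Ground)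
    (h : r.toClause ∈ CT.clauses) : CT.SatisfiesReq r := by
  cases r with
  | ext T T' =>
    rw [← hg.1.name_toName, ← hg.2.name_toName]
    exact .ext h
  | init T Ts =>
    rw [← hg.1.name_toName, ← map_name_toName hg.2]
    exact .init h
  | field T f T' =>
    rw [← hg.1.name_toName, ← hg.2.name_toName]
    exact .field (.here h)
  | method o T m Ts T' =>
    rw [← hg.1.name_toName, ← map_name_toName hg.2.1, ← hg.2.2.name_toName]
    cases o with
    | false => exact .method (.here h)
    | true =>
      -- The clause in the receiver itself blocks inherited methods, and uniqueness of clauses fixes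
      -- the signature.
      refine .optMethod fun Ds D' hmt => ?_
      cases hmt with
      | here h' =>
        have heq := CT.unique _ h' _ h rfl
        injection heq with _ _ h₁ h₂
        exact ⟨h₁, h₂⟩
      | up hn => exact absurd h (hn _ _)

theorem substReqs_ground {σ : Subst} {CR : ClassReqs} (h : GroundReqs (substReqs σ CR))
    {p : CReq × Cond} (hp : p ∈ CR) : (p.1.subst σ).Ground :=
  (h _ ⟨p, hp, rfl⟩).1

/-- A finite functional inheritance relation that records the inheritance demanded by coherent
ground requirements extends to a class table with the clauses of all the requirements. -/
theorem Coherent.exists_classTable {Sg : Set (CName × CName)} {σ : Subst} {CR : ClassReqs}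
    (h : Coherent σ CR) (hground : GroundReqs (substReqs σ CR))
    (hSg : ∃ CT₀ : ClassTable, CT₀.ext = Sg)
    (hinh : ∀ (C D : CName) (cond : Cond),
      (CReq.ext (.name C) (.name D), cond) ∈ substReqs σ CR → cond.Holds → (C, D) ∈ Sg) :
    ∃ CT : ClassTable, CT.ext = Sg ∧ ∀ p ∈ CR, CT.SatisfiesReq (p.1.subst σ) := by
  obtain ⟨CT₀, rfl⟩ := hSg
  -- Here the condition of `p` may fail; `hinh` is applied to a live counterpart `q`, which has the
  -- same clause.
  have hext : ∀ p ∈ CR, p.1.slot = .ext → ∃ C D, (p.1.subst σ).toClause = .ext C D ∧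
      (C, D) ∈ CT₀.ext := by
    intro p hp hs
    obtain ⟨q, hq, hqs, hqr, hl⟩ := h.live p hp
    have he := h.consistent q hq p hp hqs hqr
    have hg := substReqs_ground hground hq
    have hq' : (q.1.subst σ, q.2.map (CondAtom.subst σ)) ∈ substReqs σ CR := ⟨q, hq, rfl⟩
    rw [← CReq.toClause_strict, ← he, CReq.toClause_strict]
    have hs' : (q.1.subst σ).slot = .ext := by rw [CReq.subst_slot, hqs, hs]
    revert hq' hs' hg
    cases q.1.subst σ with
    | ext T T' =>
      rintro hg hq' -
      obtain ⟨⟨C, rfl⟩, D, rfl⟩ := hg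
      exact ⟨C, D, rfl, hinh C D _ hq' hl⟩
    | _ => simp [CReq.slot]
  have hcr : ∀ p ∈ CR, ∀ q ∈ CR, (p.1.subst σ).toClause.dom = (q.1.subst σ).toClause.dom →
      (p.1.subst σ).toClause = (q.1.subst σ).toClause := by
    intro p hp q hq hd
    simp only [CReq.dom_toClause, CReq.subst_slot, Prod.mk.injEq] at hd
    have hr : (p.1.subst σ).recv = (q.1.subst σ).recv := by
      rw [← (substReqs_ground hground hp).recv.name_toName,
        ← (substReqs_ground hground hq).recv.name_toName, hd.1]
    rw [CReq.subst_recv, CReq.subst_recv] at hr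
    rw [← CReq.toClause_strict, h.consistent p hp q hq hd.2 hr, CReq.toClause_strict]
  -- A kept clause can share its domain only with an `extends` requirement, whose clause is already
  -- in `CT₀` by `hext`.
  have hcross : ∀ c ∈ CT₀.clauses, c.dom.2 = .ext → ∀ p ∈ CR,
      c.dom = (p.1.subst σ).toClause.dom → c = (p.1.subst σ).toClause := by
    intro c hc hcs p hp hd
    have hs : p.1.slot = .ext := by
      rw [← CReq.subst_slot σ, ← hcs, hd, CReq.dom_toClause]
    obtain ⟨C, D, he, hCD⟩ := hext p hp hs
    rw [he] at hd ⊢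
    exact CT₀.unique c hc _ hCD hd
  refine ⟨⟨{c ∈ CT₀.clauses | c.dom.2 = .ext} ∪ (fun p => (p.1.subst σ).toClause) '' CR,
    (CT₀.finite.subset fun c hc => hc.1).union (h.finite.image _), ?_⟩, ?_, ?_⟩
  · rintro c (⟨hc, hs⟩ | ⟨p, hp, rfl⟩) c' (⟨hc', hs'⟩ | ⟨p', hp', rfl⟩) hd
    · exact CT₀.unique c hc c' hc' hd
    · exact hcross c hc hs p' hp' hd
    · exact (hcross c' hc' hs' p hp hd.symm).symm
    · exact hcr p hp p' hp' hd
  · ext ⟨C, D⟩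
    constructor
    · rintro (⟨hc, -⟩ | ⟨p, hp, he⟩)
      · exact hc
      · have hs : p.1.slot = .ext := by
          have hd := congrArg (fun c => c.dom.2) he
          simp only [CReq.dom_toClause, CReq.subst_slot] at hd
          exact hd
        obtain ⟨C', D', he', hCD⟩ := hext p hp hs
        obtain ⟨rfl, rfl⟩ := Clause.ext.inj (he'.symm.trans he)
        exact hCD
    · exact fun hc => Or.inl ⟨hc, rfl⟩
  · exact fun p hp =>
      satisfiesReq_of_toClause_mem (substReqs_ground hground hp) (Or.inr ⟨p, hp, rfl⟩)

end FJ

theorem mainTheorem6 (L : FJ.ClassDecl) (S : Set FJ.Constraint) (CR : FJ.ClassReqs)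
    (Sg : Set (FJ.CName × FJ.CName)) (σ : FJ.Subst)
    (hL : FJ.CoClassOK L S CR)
    (hsolve : FJ.Solves Sg S σ)
    (hground : FJ.GroundReqs (FJ.substReqs σ CR))
    (hSg : ∃ CT₀ : FJ.ClassTable, CT₀.ext = Sg)
    (hinh : ∀ (C D : FJ.CName) (cond : FJ.Cond),
      (FJ.CReq.ext (.name C) (.name D), cond) ∈ FJ.substReqs σ CR →
      FJ.Cond.Holds cond → (C, D) ∈ Sg) :
    ∃ CT : FJ.ClassTable,
      FJ.ClassOK CT L ∧ CT.Satisfies (FJ.substReqs σ CR) ∧ CT.ext = Sg := by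
  obtain ⟨CT, rfl, hCT⟩ := (hL.coherent hsolve).exists_classTable hground hSg hinh
  refine ⟨CT, hL.classOK hsolve hCT, ?_, rfl⟩
  -- The condition is discarded, since the table satisfies the requirement in any case.
  rintro _ ⟨p, hp, rfl⟩ -
  exact hCT p hp
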